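/- Let $g\ge 3$ and $L\ge 2$ be integers with $2\mid L$ and $4\nmid L$. Let $\Sigma_g$ be a closed oriented surface of genus $g$, and let $\mathrm{Sp}_{2g}(\mathbb Z/L)$ be the group of $2g\times 2g$ matrices over $\mathbb Z/L$ that preserve the standard symplectic form. It acts on $H_1(\Sigma_g;\mathbb Z/2)\cong(\mathbb Z/2)^{2g}$ by reducing matrices modulo $2$ and applying them with respect to a symplectic basis $a_1,\dots,a_g,b_1,\dots,b_g$ for the algebraic intersection pairing. Then the first group homology with these twisted coefficients satisfies $$H_1\bigl(\mathrm{Sp}_{2g}(\mathbb Z/L);\,H_1(\Sigma_g;\mathbb Z/2)\bigr)\;\cong\;\mathbb Z/2 .$$ -/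

import Mathlib

open scoped Matrix

/-!
The closed oriented surface of genus `g ≥ 1` is taken with its standard cell structure: one vertex,
`2g` oriented edges `a₁, …, a_g, b₁, …, b_g`, and one face, glued along `[a₁, b₁] ⋯ [a_g, b_g]`
(the `4g`-gon with its sides identified in pairs). Its first homology is the first homology of the
cellular chain complex `C₂ → C₁ → C₀`.
-/

namespace Surface

/-- The edges of the cell structure: `Sum.inl i` is the loop `a_i`, `Sum.inr i` the loop `b_i`. -/
abbrev Edge (g : ℕ) : Type := Fin g ⊕ Fin g

/-- The attaching word `[a₁, b₁] ⋯ [a_g, b_g]` of the face. -/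
def faceWord (g : ℕ) : FreeGroup (Edge g) :=
  (List.ofFn fun i : Fin g =>
    FreeGroup.of (Sum.inl i : Edge g) * FreeGroup.of (Sum.inr i : Edge g) *
      (FreeGroup.of (Sum.inl i))⁻¹ * (FreeGroup.of (Sum.inr i))⁻¹).prod

/-- The cellular 1-chain of an edge path: each edge is counted as often as the path runs through it,
with signs for the direction. -/
def wordChain (g : ℕ) (R : Type) [CommRing R] :
    FreeGroup (Edge g) →* Multiplicative (Edge g → R) :=
  FreeGroup.lift fun e => Multiplicative.ofAdd (Pi.single e 1)

/-- The boundary `C₂ = R → C₁ = R^{2g}`: it sends the face to the chain of its attaching word. -/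
def boundary₂ (g : ℕ) (R : Type) [CommRing R] : R →ₗ[R] (Edge g → R) :=
  LinearMap.toSpanSingleton R (Edge g → R) (wordChain g R (faceWord g)).toAdd

/-- The boundary `C₁ = R^{2g} → C₀ = R`: end point minus starting point of each edge, and both
are the only vertex. -/
def boundary₁ (g : ℕ) (R : Type) [CommRing R] : (Edge g → R) →ₗ[R] R :=
  ∑ e : Edge g, ((1 : R) - 1) • LinearMap.proj e

/-- `H₁(Σ_g; R)`: cellular 1-cycles modulo cellular 1-boundaries. -/
abbrev H1 (g : ℕ) (R : Type) [CommRing R] : Type :=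
  LinearMap.ker (boundary₁ g R) ⧸
    (LinearMap.range (boundary₂ g R)).submoduleOf (LinearMap.ker (boundary₁ g R))

theorem boundary₁_eq_zero (g : ℕ) (R : Type) [CommRing R] : boundary₁ g R = 0 := by
  simp [boundary₁]

theorem wordChain_faceWord (g : ℕ) (R : Type) [CommRing R] : wordChain g R (faceWord g) = 1 := by
  rw [faceWord, map_list_prod]
  apply List.prod_eq_one
  simp only [List.map_ofFn, List.mem_ofFn]
  rintro x ⟨i, rfl⟩
  simp only [Function.comp_apply, map_mul, map_inv]
  rw [mul_inv_cancel_comm, mul_inv_cancel]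

theorem boundary₂_eq_zero (g : ℕ) (R : Type) [CommRing R] : boundary₂ g R = 0 := by
  ext
  simp [boundary₂, wordChain_faceWord]

theorem boundaries_eq_bot (g : ℕ) (R : Type) [CommRing R] :
    (LinearMap.range (boundary₂ g R)).submoduleOf (LinearMap.ker (boundary₁ g R)) = ⊥ := by
  rw [boundary₂_eq_zero, LinearMap.range_zero]
  exact Submodule.ker_subtype _

/-- As both boundary maps vanish, `H₁(Σ_g; R)` is identified with the 1-chains. -/
def h1Equiv (g : ℕ) (R : Type) [CommRing R] : H1 g R ≃ₗ[R] (Edge g → R) :=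
  (Submodule.quotEquivOfEqBot _ (boundaries_eq_bot g R)).trans
    (LinearEquiv.ofTop _ (LinearMap.ker_eq_top.2 (boundary₁_eq_zero g R)))

/-- The basis of `H₁(Σ_g; R)` formed by the classes of the loops `a₁, …, a_g, b₁, …, b_g`. For the
algebraic intersection pairing it is a symplectic basis:
`i(a_i, b_j) = δ_{ij}` and `i(a_i, a_j) = i(b_i, b_j) = 0`. -/
noncomputable def symplecticBasis (g : ℕ) (R : Type) [CommRing R] :
    Module.Basis (Edge g) R (H1 g R) :=
  Module.Basis.ofEquivFun (h1Equiv g R)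

/-- The action of `Sp_{2g}(ℤ/L)`, for `L` even, on `H₁(Σ_g; ℤ/2)`: reduce the matrix modulo 2 and
let it act through the symplectic basis of loops. -/
noncomputable def symplecticRep (g L : ℕ) (h : 2 ∣ L) :
    Representation (ZMod 2) (Matrix.symplecticGroup (Fin g) (ZMod L)) (H1 g (ZMod 2)) where
  toFun M := Matrix.toLin (symplecticBasis g (ZMod 2)) (symplecticBasis g (ZMod 2))
    ((M : Matrix (Edge g) (Edge g) (ZMod L)).map (ZMod.castHom h (ZMod 2)))
  map_one' := by
    rw [OneMemClass.coe_one, Matrix.map_one _ (map_zero _) (map_one _), Matrix.toLin_one]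
    rfl
  map_mul' M N := by
    rw [Submonoid.coe_mul, Matrix.map_mul,
      Matrix.toLin_mul _ (symplecticBasis g (ZMod 2))]
    rfl

end Surface

/-! The dual of H₁(G; V) is H¹(G; V*), so the claim is that H¹(G; V*) is a line. As `L / 2` is odd,
multiplication by it embeds ℤ/2 in ℤ/L as a ℤ/L-linear section of reduction. Hence each v ∈ V has a
transvection T_v in G with g T_v g⁻¹ = T_{gv} (`transvectionFamily`). This relation forces ψ(T_v) =
c(v) ω(·, v) for every cocycle ψ and v ≠ 0, and makes ψ the coboundary of the possibly nonlinear
function c (`exists_weight`). Taking g = T_v shows that c is additive on non-orthogonal pairs; on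
distinct nonzero orthogonal pairs its defect is a constant ε (`exists_defect`). Up to an invariant
indicator function, c is therefore linear plus ε q, with q a quadratic refinement of ω
(`cocycle_eq`). The class of q is nonzero (`not_coboundary`). -/

/-- A symplectic form on an `𝔽₂`-representation of `G`, preserved by `G`, together with a
`G`-equivariant family of elements of `G` acting as the symplectic transvections. -/
structure TransvectionFamily {G V : Type*} [Group G] [AddCommGroup V] [Module (ZMod 2) V]
    (ρ : Representation (ZMod 2) G V) where
  form : LinearMap.BilinForm (ZMod 2) V
  alt : ∀ x, form x x = 0
  nondegenerate : form.Nondegenerate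
  invariant : ∀ g x y, form (ρ g x) (ρ g y) = form x y
  elt : V → G
  elt_apply : ∀ v x, ρ (elt v) x = x + form x v • v
  mul_elt : ∀ g v, g * elt v = elt (ρ g v) * g

/-- Inhomogeneous 1-cocycles with values in the dual representation. -/
def IsDualCocycle {G V : Type*} [Group G] [AddCommGroup V] [Module (ZMod 2) V]
    (ρ : Representation (ZMod 2) G V) (ψ : G → Module.Dual (ZMod 2) V) : Prop :=
  ∀ g h a, ψ (g * h) a = ψ g a + ψ h (ρ g⁻¹ a)

theorem ZMod.two_eq_zero_or_eq_one (x : ZMod 2) : x = 0 ∨ x = 1 := by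
  revert x; decide

/-! ### Symplectic linear algebra over 𝔽₂ -/

namespace TransvectionFamily

variable {G V : Type*} [Group G] [AddCommGroup V] [Module (ZMod 2) V]
  {ρ : Representation (ZMod 2) G V} (T : TransvectionFamily ρ)

theorem form_comm (x y : V) : T.form x y = T.form y x := by
  have h := T.alt (x + y)
  simp only [map_add, LinearMap.add_apply, T.alt, zero_add, add_zero] at h
  rw [← CharTwo.add_eq_zero, add_comm, h]

theorem elt_inv_apply (v a : V) : ρ (T.elt v)⁻¹ a = a + T.form a v • v := by
  apply (ρ.apply_bijective (T.elt v)).1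
  rw [ρ.self_inv_apply, T.elt_apply]
  simp [T.alt, add_assoc, ZModModule.add_self]

/-- Separation of a vector from a subspace by the symplectic form. -/
theorem exists_form_eq_one [FiniteDimensional (ZMod 2) V] (W : Submodule (ZMod 2) V) {v : V}
    (hv : v ∉ W) : ∃ x, (∀ w ∈ W, T.form x w = 0) ∧ T.form x v = 1 := by
  obtain ⟨f, hf, hW⟩ := Submodule.exists_le_ker_of_notMem hv
  refine ⟨(T.form.toDual T.nondegenerate).symm f, fun w hw => ?_, ?_⟩
  · rw [LinearMap.BilinForm.apply_toDual_symm_apply]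
    exact hW hw
  · rw [LinearMap.BilinForm.apply_toDual_symm_apply]
    exact (ZMod.two_eq_zero_or_eq_one _).resolve_left hf

theorem exists_form_left [FiniteDimensional (ZMod 2) V] {v : V} (hv : v ≠ 0) :
    ∃ x, T.form x v = 1 := by
  obtain ⟨x, -, hx⟩ := T.exists_form_eq_one ⊥ (by simpa using hv)
  exact ⟨x, hx⟩

theorem mem_span_singleton_iff {v w : V} :
    v ∈ Submodule.span (ZMod 2) {w} ↔ v = 0 ∨ v = w := by
  rw [Submodule.mem_span_singleton]
  constructor
  · rintro ⟨a, rfl⟩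
    rcases ZMod.two_eq_zero_or_eq_one a with rfl | rfl <;> simp
  · rintro (rfl | rfl)
    · exact ⟨0, by simp⟩
    · exact ⟨1, by simp⟩

theorem exists_form_pair [FiniteDimensional (ZMod 2) V] {v w : V} (hv : v ≠ 0) (hw : v ≠ w) :
    ∃ x, T.form x w = 0 ∧ T.form x v = 1 := by
  obtain ⟨x, h, hx⟩ := T.exists_form_eq_one (Submodule.span (ZMod 2) {w}) (v := v)
    (by rw [mem_span_singleton_iff]; tauto)
  exact ⟨x, h _ (Submodule.mem_span_singleton_self w), hx⟩

/-- Two vectors outside the line of `w` pair to one with a common vector orthogonal to `w`. -/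
theorem exists_common_neighbour [FiniteDimensional (ZMod 2) V] {v y w : V} (hv : v ≠ 0)
    (hvw : v ≠ w) (hy : y ≠ 0) (hyw : y ≠ w) :
    ∃ x, T.form x w = 0 ∧ T.form x v = 1 ∧ T.form x y = 1 := by
  obtain ⟨x, h0, h1⟩ := T.exists_form_pair hv hvw
  rcases ZMod.two_eq_zero_or_eq_one (T.form x y) with hxy | hxy
  swap
  · exact ⟨x, h0, h1, hxy⟩
  -- In the span of w and v, only 0 and w are orthogonal to x.
  have hmem : y ∉ Submodule.span (ZMod 2) {w, v} := by
    rw [Submodule.mem_span_insert]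
    rintro ⟨a, z, hz, rfl⟩
    rw [mem_span_singleton_iff] at hz
    rcases hz with rfl | rfl
    · rcases ZMod.two_eq_zero_or_eq_one a with rfl | rfl <;> simp at hy hyw
    · simp [h0, h1] at hxy
  obtain ⟨z, hz, hz1⟩ := T.exists_form_eq_one _ hmem
  have hzw := hz w (Submodule.subset_span (by simp))
  have hzv := hz v (Submodule.subset_span (by simp))
  exact ⟨x + z, by simp [h0, hzw], by simp [h1, hzv], by simp [hxy, hz1]⟩

/-- In dimension at least six, any two vectors have a common orthogonal vector which is nonzero and
different from both. -/
theorem exists_orthogonal [FiniteDimensional (ZMod 2) V] (hdim : 6 ≤ Module.finrank (ZMod 2) V)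
    (v w : V) : ∃ x, x ≠ 0 ∧ x ≠ v ∧ x ≠ w ∧ T.form v x = 0 ∧ T.form w x = 0 := by
  set W := Submodule.span (ZMod 2) ({v, w} : Set V)
  have h1 := LinearMap.BilinForm.finrank_orthogonal T.nondegenerate W
  have h2 : Module.finrank (ZMod 2) W ≤ 2 := by
    classical
    have := finrank_span_finset_le_card (R := ZMod 2) ({v, w} : Finset V)
    simp only [Finset.coe_insert, Finset.coe_singleton] at this
    exact this.trans Finset.card_le_two
  -- The complement has dimension at least 4, while `W` has dimension at most 2.
  have h3 : ¬ T.form.orthogonal W ≤ W := fun h => by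
    have := Submodule.finrank_mono h
    lia
  obtain ⟨x, hx, hxW⟩ := SetLike.not_le_iff_exists.1 h3
  have hv : v ∈ W := Submodule.subset_span (by simp)
  have hw : w ∈ W := Submodule.subset_span (by simp)
  exact ⟨x, fun h => hxW (h ▸ W.zero_mem), fun h => hxW (h ▸ hv), fun h => hxW (h ▸ hw),
    hx v hv, hx w hw⟩

/-! ### Cocycles on transvections -/

section Cocycle

variable {ψ : G → Module.Dual (ZMod 2) V} (hψ : IsDualCocycle ρ ψ)

include hψ in
-- Expand ψ on both sides of g T_w = T_{gw} g.
theorem cocycle_elt_conj (g : G) (w a : V) :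
    ψ (T.elt (ρ g w)) a = ψ (T.elt w) (ρ g⁻¹ a) + T.form a (ρ g w) * ψ g (ρ g w) := by
  have h := hψ g (T.elt w) a
  rw [T.mul_elt, hψ, T.elt_inv_apply, map_add, map_smul, smul_eq_mul] at h
  have h2 : ψ g a + ψ g a = 0 := CharTwo.add_self_eq_zero _
  have h3 : ∀ x : ZMod 2, x + x = 0 := CharTwo.add_self_eq_zero
  linear_combination h - h3 (T.form a (ρ g w) * ψ g (ρ g w))

include hψ in
-- For w ≠ v, T_w fixes v; conjugating T_v by it and evaluating at some a orthogonal to v but not to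
-- w isolates ψ(T_v)(w). For w = v, write v = (v + x) + x with x orthogonal to v.
theorem cocycle_elt_orthogonal [FiniteDimensional (ZMod 2) V]
    (hdim : 6 ≤ Module.finrank (ZMod 2) V) {v w : V} (hv : v ≠ 0) (hvw : T.form w v = 0) :
    ψ (T.elt v) w = 0 := by
  have key : ∀ w, w ≠ v → T.form w v = 0 → ψ (T.elt v) w = 0 := by
    intro w hwv hvw
    by_cases hw : w = 0
    · simp [hw]
    have h1 : ρ (T.elt w) v = v := by rw [T.elt_apply, T.form_comm, hvw]; simp
    obtain ⟨a, ha, ha'⟩ := T.exists_form_pair hw hwv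
    have h2 := T.cocycle_elt_conj hψ (T.elt w) v a
    rw [h1, T.elt_inv_apply, ha, ha'] at h2
    simpa using h2
  by_cases h : w = v
  · subst h
    obtain ⟨x, hx0, hxw, -, hx, -⟩ := T.exists_orthogonal hdim w w
    have hx' : T.form x w = 0 := by rw [T.form_comm, hx]
    have h3 := key x hxw hx'
    have h4 := key (w + x) (by simpa using hx0) (by simp [T.alt, hx'])
    rw [map_add, h3, add_zero] at h4
    exact h4
  · exact key w h hvw

include hψ in
/-- On a transvection, a cocycle is a multiple of the form; the multiple determines the cocycle. -/
theorem exists_weight [FiniteDimensional (ZMod 2) V]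
    (hdim : 6 ≤ Module.finrank (ZMod 2) V) :
    ∃ c : V → ZMod 2, c 0 = 0 ∧ (∀ v, v ≠ 0 → ∀ a, ψ (T.elt v) a = c v * T.form a v) ∧
      ∀ g w, c (ρ g w) = c w + ψ g (ρ g w) := by
  have h : ∀ v : V, ∃ c : ZMod 2, (v = 0 → c = 0) ∧
      (v ≠ 0 → ∀ a, ψ (T.elt v) a = c * T.form a v) := by
    intro v
    by_cases hv : v = 0
    · exact ⟨0, fun _ => rfl, fun h => (h hv).elim⟩
    obtain ⟨x, hx⟩ := T.exists_form_left hv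
    refine ⟨ψ (T.elt v) x, fun h => (hv h).elim, fun _ a => ?_⟩
    have := T.cocycle_elt_orthogonal hψ hdim hv (w := a + T.form a v • x)
      (by simp [hx, CharTwo.add_self_eq_zero])
    rw [map_add, map_smul, smul_eq_mul, CharTwo.add_eq_zero] at this
    rw [this, mul_comm]
  choose c hc0 hc using h
  refine ⟨c, hc0 0 rfl, hc, fun g w => ?_⟩
  by_cases hw : w = 0
  · simp [hw, hc0]
  have hgw : ρ g w ≠ 0 := fun h => hw ((ρ.apply_bijective g).1 (by simp [h]))
  obtain ⟨a, ha⟩ := T.exists_form_left hgw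
  have h1 := T.cocycle_elt_conj hψ g w a
  have h2 : T.form (ρ g⁻¹ a) w = T.form a (ρ g w) := by
    rw [← T.invariant g, ρ.self_inv_apply]
  rw [hc _ hgw, hc _ hw, h2, ha] at h1
  simpa using h1

end Cocycle

/-! ### Weight functions and quadratic refinements -/

/-- A function that is additive on non-orthogonal pairs has constant defect of additivity on
orthogonal pairs. -/
theorem exists_defect [FiniteDimensional (ZMod 2) V] (hdim : 6 ≤ Module.finrank (ZMod 2) V)
    (c : V → ZMod 2) (hc : ∀ v w, T.form v w = 1 → c (v + w) = c v + c w) :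
    ∃ ε : ZMod 2, ∀ v w, v ≠ 0 → w ≠ 0 → v ≠ w → T.form v w = 0 →
      c v + c w + c (v + w) = ε := by
  set β : V → V → ZMod 2 := fun v w => c v + c w + c (v + w) with hβ
  have β_comm : ∀ v w, β v w = β w v := fun v w => by
    simp only [hβ]; rw [add_comm v w, add_comm (c v)]
  -- Additivity on the pairs (v, v + y) and (v + w, v + y) changes both terms by c(v + y).
  have step : ∀ v y w, T.form v w = 0 → T.form y w = 0 → T.form v y = 1 → β v w = β y w := by
    intro v y w hv hy hvy
    have h1 : c (v + (v + y)) = c v + c (v + y) := hc _ _ (by simp [T.alt, hvy])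
    have h2 : c ((v + w) + (v + y)) = c (v + w) + c (v + y) :=
      hc _ _ (by simp [T.alt, hvy, T.form_comm w, hv, hy])
    rw [show v + (v + y) = y by rw [← add_assoc, ZModModule.add_self, zero_add]] at h1
    rw [show (v + w) + (v + y) = y + w by
      rw [add_add_add_comm, ZModModule.add_self, zero_add, add_comm]] at h2
    simp only [hβ]
    rw [h1, h2]
    have h3 : ∀ x : ZMod 2, x + x = 0 := CharTwo.add_self_eq_zero
    linear_combination - h3 (c (v + y))
  have fixed : ∀ v y w, v ≠ 0 → v ≠ w → y ≠ 0 → y ≠ w → T.form v w = 0 → T.form y w = 0 →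
      β v w = β y w := by
    intro v y w hv hvw hy hyw h1 h2
    obtain ⟨x, hx, hxv, hxy⟩ := T.exists_common_neighbour hv hvw hy hyw
    rw [step v x w h1 hx (by rw [T.form_comm, hxv]), step x y w hx h2 hxy]
  have hall : ∀ v w v' w', v ≠ 0 → w ≠ 0 → v ≠ w → T.form v w = 0 →
      v' ≠ 0 → w' ≠ 0 → v' ≠ w' → T.form v' w' = 0 → β v w = β v' w' := by
    -- With x orthogonal to w and w', move through (v, w), (x, w), (x, w'), (v', w'), changing one
    -- entry at a time.
    intro v w v' w' hv hw hvw h hv' hw' hvw' h'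
    obtain ⟨x, hx, hxw, hxw', h1, h2⟩ := T.exists_orthogonal hdim w w'
    have h1' : T.form x w = 0 := by rw [T.form_comm, h1]
    have h2' : T.form x w' = 0 := by rw [T.form_comm, h2]
    rw [fixed v x w hv hvw hx hxw h h1', fixed v' x w' hv' hvw' hx hxw' h' h2', β_comm x w,
      β_comm x w', fixed w w' x hw hxw.symm hw' hxw'.symm h1 h2]
  by_cases hex : ∃ v w, v ≠ 0 ∧ w ≠ 0 ∧ v ≠ w ∧ T.form v w = 0
  · obtain ⟨v, w, h1, h2, h3, h4⟩ := hex
    exact ⟨β v w, fun v' w' h1' h2' h3' h4' => hall v' w' v w h1' h2' h3' h4' h1 h2 h3 h4⟩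
  · push Not at hex
    exact ⟨0, fun v w h1 h2 h3 h4 => (hex v w h1 h2 h3 h4).elim⟩

/-- Every cocycle is cohomologous to a multiple of the one measuring the failure of a quadratic
refinement `q` of the form to be invariant. -/
theorem cocycle_eq [FiniteDimensional (ZMod 2) V] (hdim : 6 ≤ Module.finrank (ZMod 2) V)
    {q : V → ZMod 2} (hq : ∀ x y, q (x + y) = q x + q y + T.form x y)
    {ψ : G → Module.Dual (ZMod 2) V} (hψ : IsDualCocycle ρ ψ) :
    ∃ (ε : ZMod 2) (l : Module.Dual (ZMod 2) V), ∀ g a,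
      ψ g a = ε * (q (ρ g⁻¹ a) - q a) + (l (ρ g⁻¹ a) - l a) := by
  classical
  obtain ⟨c, hc0, hcT, hcg⟩ := T.exists_weight hψ hdim
  have hc : ∀ v w, T.form v w = 1 → c (v + w) = c v + c w := by
    intro v w h
    have hv : v ≠ 0 := by rintro rfl; simp at h
    have h1 := hcg (T.elt v) w
    have h2 : ρ (T.elt v) w = v + w := by
      rw [T.elt_apply, T.form_comm, h, one_smul, add_comm]
    rw [h2, hcT v hv] at h1
    rw [h1]
    simp [T.alt, T.form_comm w v, h, add_comm]
  obtain ⟨ε, hε⟩ := T.exists_defect hdim c hc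
  have hq0 : q 0 = 0 := by simpa using hq 0 0
  have h3 : ∀ x : ZMod 2, x + x = 0 := CharTwo.add_self_eq_zero
  -- On distinct nonzero pairs the indicator of v ≠ 0 has defect 1, so q plus the indicator has
  -- defect ω + 1, and ε times it cancels the defect of c. The indicator is G-invariant and drops
  -- out of the coboundary.
  let l₀ : V → ZMod 2 := fun v => c v + ε * (q v + if v = 0 then 0 else 1)
  have l₀_add : ∀ v w, l₀ (v + w) = l₀ v + l₀ w := by
    intro v w
    by_cases hv : v = 0
    · simp [l₀, hv, hc0, hq0]
    by_cases hw : w = 0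
    · simp [l₀, hw, hc0, hq0]
    by_cases hvw : v = w
    · subst hvw
      rw [h3, ZModModule.add_self]
      simp [l₀, hc0, hq0]
    have hs : v + w ≠ 0 := fun h => hvw (by
      rw [← add_zero v, ← ZModModule.add_self w, ← add_assoc, h, zero_add])
    simp only [l₀, hv, hw, hs, if_false, hq]
    rcases ZMod.two_eq_zero_or_eq_one (T.form v w) with h | h
    · have := hε v w hv hw hvw h
      rw [h]
      linear_combination this - h3 (c v) - h3 (c w)
    · rw [hc v w h, h]
      ring
  let l : Module.Dual (ZMod 2) V :=
    (AddMonoidHom.mk' l₀ l₀_add).toZModLinearMap 2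
  have hl : ∀ v, l v = c v + ε * (q v + if v = 0 then 0 else 1) := fun v => rfl
  refine ⟨ε, l, fun g a => ?_⟩
  have h1 := hcg g (ρ g⁻¹ a)
  rw [ρ.self_inv_apply] at h1
  have h2 : (ρ g⁻¹ a = 0) ↔ a = 0 :=
    ⟨fun h => (ρ.apply_bijective g⁻¹).1 (by simp [h]), fun h => by simp [h]⟩
  rw [hl, hl]
  simp only [h2, h1]
  linear_combination h3 (ψ g a) - h3 (ε * (q (ρ g⁻¹ a) - q a))

/-- The cocycle of a quadratic refinement is not a coboundary. -/
theorem not_coboundary [FiniteDimensional (ZMod 2) V] (hdim : 6 ≤ Module.finrank (ZMod 2) V)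
    {q : V → ZMod 2} (hq : ∀ x y, q (x + y) = q x + q y + T.form x y)
    (l : Module.Dual (ZMod 2) V) : ¬ ∀ g a, q (ρ g⁻¹ a) - q a = l (ρ g⁻¹ a) - l a := by
  intro h
  -- Evaluate at T_v and some x with ω(x, v) = 1. Then q + 1 would be additive on a distinct nonzero
  -- orthogonal pair, which is absurd.
  have hq' : ∀ v, v ≠ 0 → q v + 1 = l v := by
    intro v hv
    obtain ⟨x, hx⟩ := T.exists_form_left hv
    have := h (T.elt v) x
    rw [T.elt_inv_apply, hx, one_smul, hq, hx, map_add] at this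
    linear_combination this
  have : Nontrivial V := Module.finrank_pos_iff.1 (by lia : 0 < Module.finrank (ZMod 2) V)
  obtain ⟨v, hv⟩ := exists_ne (0 : V)
  obtain ⟨w, hw, hwv, -, h0, -⟩ := T.exists_orthogonal hdim v v
  have hs : v + w ≠ 0 := fun h => hwv (by
    rw [← add_zero w, ← ZModModule.add_self v, ← add_assoc, add_comm w v, h, zero_add])
  have h1 := hq' _ hs
  rw [hq, h0, map_add, ← hq' v hv, ← hq' w hw] at h1
  have h2 : (1 : ZMod 2) = 0 := by linear_combination -h1
  exact one_ne_zero h2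

end TransvectionFamily

/-! ### Duality between first homology and cocycles -/

namespace groupHomology

open Finsupp

variable {G V : Type} [Group G] [AddCommGroup V] [Module (ZMod 2) V]
  (ρ : Representation (ZMod 2) G V)

theorem isDualCocycle_of_le_ker (f : (G →₀ V) →ₗ[ZMod 2] ZMod 2)
    (hf : boundaries₁ (Rep.of ρ) ≤ LinearMap.ker f) :
    IsDualCocycle ρ fun g => f ∘ₗ lsingle g := by
  intro g h a
  have h1 : f (d₂₁ (Rep.of ρ) (single (g, h) a)) = 0 := hf ⟨_, rfl⟩
  rw [d₂₁_single] at h1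
  simp only [map_add, map_sub] at h1
  simp only [LinearMap.comp_apply, lsingle_apply]
  linear_combination -h1

theorem boundaries_le_ker {ψ : G → Module.Dual (ZMod 2) V} (hψ : IsDualCocycle ρ ψ) :
    boundaries₁ (Rep.of ρ) ≤ LinearMap.ker (Finsupp.lsum (ZMod 2) ψ) := by
  rintro _ ⟨x, rfl⟩
  rw [LinearMap.mem_ker]
  induction x using Finsupp.induction_linear with
  | zero => simp
  | add x y hx hy => rw [map_add, map_add, hx, hy, add_zero]
  | single gh a =>
    have := hψ gh.1 gh.2 a
    erw [d₂₁_single]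
    simp only [map_add, map_sub]
    erw [Finsupp.lsum_single, Finsupp.lsum_single, Finsupp.lsum_single, this]
    ring

/-- The cocycle of a quadratic refinement. -/
def quadraticCocycle {ω : LinearMap.BilinForm (ZMod 2) V}
    (hinv : ∀ g x y, ω (ρ g x) (ρ g y) = ω x y) {q : V → ZMod 2}
    (hq : ∀ x y, q (x + y) = q x + q y + ω x y) (g : G) : Module.Dual (ZMod 2) V :=
  (AddMonoidHom.mk' (fun a => q (ρ g⁻¹ a) - q a) fun a b => by
    rw [map_add, hq, hq, hinv]; ring).toZModLinearMap 2

theorem nonempty_addEquiv_zmod_two [FiniteDimensional (ZMod 2) V] (T : TransvectionFamily ρ)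
    (hdim : 6 ≤ Module.finrank (ZMod 2) V) {q : V → ZMod 2}
    (hq : ∀ x y, q (x + y) = q x + q y + T.form x y) :
    Nonempty (groupHomology (Rep.of ρ) 1 ≃+ ZMod 2) := by
  set ψ := quadraticCocycle ρ T.invariant hq with hψdef
  have ψ_apply : ∀ g a, ψ g a = q (ρ g⁻¹ a) - q a := fun _ _ => rfl
  have hψ : IsDualCocycle ρ ψ := fun g h a => by
    simp only [ψ_apply, mul_inv_rev, map_mul, Module.End.mul_apply]; ring
  set Φ : (G →₀ V) →ₗ[ZMod 2] ZMod 2 := Finsupp.lsum (ZMod 2) ψ with hΦ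
  set F : cycles₁ (Rep.of ρ) →ₗ[ZMod 2] ZMod 2 := Φ ∘ₗ (cycles₁ (Rep.of ρ)).subtype
  have coboundary : ∀ (l : Module.Dual (ZMod 2) V) (x : G →₀ V),
      l ((d₁₀ (Rep.of ρ)).hom x) =
        Finsupp.lsum (ZMod 2) (fun g => l ∘ₗ (ρ g⁻¹ - LinearMap.id)) x := by
    intro l x
    induction x using Finsupp.induction_linear with
    | zero => simp
    | add x y hx hy => rw [map_add, map_add, hx, hy, map_add]
    | single g a =>
      rw [Finsupp.lsum_single]
      erw [d₁₀_single]
      rfl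
  have F_surj : Function.Surjective F := by
    refine LinearMap.surjective (f := F) fun h0 => ?_
    -- A functional killing all cycles factors through `d₁₀`, so its cocycle is a coboundary.
    have h1 : Φ ∈ (LinearMap.ker (d₁₀ (Rep.of ρ)).hom).dualAnnihilator := by
      rw [Submodule.mem_dualAnnihilator]
      exact fun x hx => LinearMap.congr_fun h0 (⟨x, hx⟩ : cycles₁ (Rep.of ρ))
    rw [← LinearMap.range_dualMap_eq_dualAnnihilator_ker] at h1
    obtain ⟨l, hl⟩ := h1
    refine T.not_coboundary hdim hq l fun g a => ?_
    have h2 := LinearMap.congr_fun hl (single g a)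
    rw [LinearMap.dualMap_apply, coboundary, Finsupp.lsum_single, hΦ, Finsupp.lsum_single] at h2
    rw [← ψ_apply, ← h2]
    simp
  have F_ker : ∀ z, F z = 0 ↔ z.1 ∈ boundaries₁ (Rep.of ρ) := by
    intro z
    refine ⟨fun hz => ?_, fun hz => boundaries_le_ker ρ hψ hz⟩
    by_contra hmem
    -- A functional separating z from the boundaries is a cocycle, hence εΦ plus a coboundary; both
    -- vanish on z.
    obtain ⟨f, hfz, hf⟩ := Submodule.exists_le_ker_of_notMem hmem
    obtain ⟨ε, l, h⟩ := T.cocycle_eq hdim hq (isDualCocycle_of_le_ker ρ f hf)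
    have hfe : f = ε • Φ + l ∘ₗ (d₁₀ (Rep.of ρ)).hom := by
      refine Finsupp.lhom_ext fun g a => ?_
      have h1 := h g a
      rw [LinearMap.add_apply, LinearMap.comp_apply, coboundary, LinearMap.smul_apply, hΦ,
        Finsupp.lsum_single, Finsupp.lsum_single, ψ_apply]
      rw [LinearMap.comp_apply, lsingle_apply] at h1
      erw [h1]
      simp
    apply hfz
    have hz' : (d₁₀ (Rep.of ρ)).hom z.1 = 0 := z.2
    have hz'' : Φ z.1 = 0 := hz
    rw [hfe, LinearMap.add_apply, LinearMap.comp_apply, hz', LinearMap.smul_apply, hz'']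
    simp
  have hker : LinearMap.ker (H1π (Rep.of ρ)).hom = LinearMap.ker F := by
    ext z
    rw [LinearMap.mem_ker, LinearMap.mem_ker, F_ker]
    exact H1π_eq_zero_iff z
  have hsurj : Function.Surjective (H1π (Rep.of ρ)).hom :=
    (ModuleCat.epi_iff_surjective _).1 inferInstance
  exact ⟨(((H1π (Rep.of ρ)).hom.quotKerEquivOfSurjective hsurj).symm.trans
    ((Submodule.quotEquivOfEq _ _ hker).trans
      (F.quotKerEquivOfSurjective F_surj))).toAddEquiv⟩

end groupHomology

/-! ### Transvections over ℤ/L and the intersection form -/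

namespace Surface

open Matrix

section Transvection

variable {l R : Type*} [DecidableEq l] [Fintype l] [CommRing R]

theorem dotProduct_J_mulVec_self (v : l ⊕ l → R) : v ⬝ᵥ J l R *ᵥ v = 0 := by
  simp [J, fromBlocks_mulVec, dotProduct, Fintype.sum_sum_type, neg_mulVec, mul_comm]

/-- The symplectic transvection `x ↦ x + ω(x, v) v`. -/
def transvection (v : l ⊕ l → R) : Matrix.symplecticGroup l R :=
  ⟨1 + vecMulVec v (J l R *ᵥ v), by
    rw [SymplecticGroup.mem_iff, transpose_add, transpose_one, transpose_vecMulVec, add_mul,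
      one_mul, mul_add, mul_one, add_mul, vecMulVec_mul, mul_vecMulVec, vecMulVec_mul_vecMulVec,
      ← mulVec_transpose, J_transpose, neg_mulVec, mulVec_mulVec, J_squared, neg_mulVec, one_mulVec,
      neg_neg, dotProduct_comm, dotProduct_comm, dotProduct_J_mulVec_self]
    simp [neg_vecMulVec]⟩

theorem coe_transvection (v : l ⊕ l → R) :
    (transvection v : Matrix (l ⊕ l) (l ⊕ l) R) = 1 + vecMulVec v (J l R *ᵥ v) := rfl

theorem transvection_map {S : Type*} [CommRing S] (f : R →+* S) (v : l ⊕ l → R) :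
    (1 + vecMulVec v (J l R *ᵥ v)).map f =
      1 + vecMulVec (f ∘ v) (J l S *ᵥ (f ∘ v)) := by
  rw [Matrix.map_add _ (map_add f), Matrix.map_one _ (map_zero f) (map_one f), ← map_J l f]
  congr 1
  ext i j
  simp [vecMulVec_apply, RingHom.map_mulVec]

theorem mul_transvection (M : Matrix.symplecticGroup l R) (v : l ⊕ l → R) :
    M * transvection v = transvection ((M : Matrix (l ⊕ l) (l ⊕ l) R) *ᵥ v) * M := by
  apply Subtype.ext
  have h := SymplecticGroup.mem_iff'.1 M.2
  rw [Submonoid.coe_mul, Submonoid.coe_mul, coe_transvection, coe_transvection, mul_add, add_mul,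
    mul_one, one_mul, mul_vecMulVec, vecMulVec_mul, ← mulVec_transpose, mulVec_mulVec,
    mulVec_mulVec, h]

end Transvection

section Lift

variable (L : ℕ) (h : 2 ∣ L)

/-- The additive embedding of `ℤ/2` in `ℤ/L`, for `L` even. -/
def halfEmbedding : ZMod 2 →+ ZMod L :=
  AddMonoidHom.mk' (fun x => (L / 2 : ℕ) * (x.val : ZMod L)) (by
    have h0 : ((L / 2 : ℕ) : ZMod L) * 2 = 0 := by
      have : ((L / 2 * 2 : ℕ) : ZMod L) = 0 := by rw [Nat.div_mul_cancel h, ZMod.natCast_self]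
      exact_mod_cast this
    intro x y
    rcases ZMod.two_eq_zero_or_eq_one x with rfl | rfl <;>
    rcases ZMod.two_eq_zero_or_eq_one y with rfl | rfl <;>
    simp [ZMod.val_one, CharTwo.add_self_eq_zero, ← mul_two, h0])

/-- This linearity over ℤ/L makes the lifted transvections equivariant under the whole group. -/
theorem halfEmbedding_castHom_mul (y : ZMod L) (x : ZMod 2) :
    halfEmbedding L h (ZMod.castHom h (ZMod 2) y * x) = y * halfEmbedding L h x := by
  obtain ⟨n, rfl⟩ := ZMod.intCast_surjective y
  rw [map_intCast, ← zsmul_eq_mul, map_zsmul, zsmul_eq_mul]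

/-- Since 4 ∤ L, the factor `L / 2` is odd and reduces to 1. -/
theorem castHom_halfEmbedding (h4 : ¬ 4 ∣ L) (x : ZMod 2) :
    ZMod.castHom h (ZMod 2) (halfEmbedding L h x) = x := by
  have h1 : ((L / 2 : ℕ) : ZMod 2) = 1 := by
    rw [ZMod.natCast_eq_one_iff_odd, Nat.odd_iff]
    lia
  change ZMod.castHom h (ZMod 2) ((L / 2 : ℕ) * (x.val : ZMod L)) = x
  rw [map_mul, map_natCast, map_natCast, h1, one_mul, ZMod.natCast_zmod_val]

end Lift

variable (g L : ℕ) (h : 2 ∣ L)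

theorem h1Equiv_symplecticRep (M : Matrix.symplecticGroup (Fin g) (ZMod L)) (x : H1 g (ZMod 2)) :
    h1Equiv g (ZMod 2) (symplecticRep g L h M x) =
      ((M : Matrix (Edge g) (Edge g) (ZMod L)).map (ZMod.castHom h (ZMod 2))) *ᵥ
        h1Equiv g (ZMod 2) x := by
  have := Matrix.repr_toLin (symplecticBasis g (ZMod 2)) (symplecticBasis g (ZMod 2))
    ((M : Matrix (Edge g) (Edge g) (ZMod L)).map (ZMod.castHom h (ZMod 2))) x
  exact this

/-- The intersection form on `H₁(Σ_g; ℤ/2)`. -/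
noncomputable def intersectionForm : LinearMap.BilinForm (ZMod 2) (H1 g (ZMod 2)) :=
  LinearMap.BilinForm.congr (h1Equiv g (ZMod 2)).symm (Matrix.toBilin' (J (Fin g) (ZMod 2)))

theorem intersectionForm_apply (x y : H1 g (ZMod 2)) :
    intersectionForm g x y =
      h1Equiv g (ZMod 2) x ⬝ᵥ J (Fin g) (ZMod 2) *ᵥ h1Equiv g (ZMod 2) y := by
  rw [intersectionForm, LinearMap.BilinForm.congr_apply, Matrix.toBilin'_apply',
    LinearEquiv.symm_symm]

theorem intersectionForm_nondegenerate : (intersectionForm g).Nondegenerate :=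
  (LinearMap.BilinForm.nondegenerate_toBilin'_of_det_ne_zero' _
    (isUnit_det_J (Fin g) (ZMod 2)).ne_zero).congr _

/-- The transvections of `Sp_{2g}(ℤ/L)`, for `L ≡ 2 mod 4`, that are trivial modulo `L / 2`. -/
noncomputable def transvectionFamily (h4 : ¬ 4 ∣ L) : TransvectionFamily (symplecticRep g L h) where
  form := intersectionForm g
  alt x := (intersectionForm_apply g x x).trans (dotProduct_J_mulVec_self _)
  nondegenerate := intersectionForm_nondegenerate g
  invariant M x y := by
    have hM := SymplecticGroup.mem_iff'.1 (SymplecticGroup.map_mem M.2 (ZMod.castHom h (ZMod 2)))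
    rw [intersectionForm_apply, intersectionForm_apply, h1Equiv_symplecticRep,
      h1Equiv_symplecticRep, mulVec_mulVec, ← vecMul_transpose, ← dotProduct_mulVec, mulVec_mulVec,
      ← mul_assoc, hM]
  elt v := transvection (halfEmbedding L h ∘ h1Equiv g (ZMod 2) v)
  elt_apply v x := by
    apply (h1Equiv g (ZMod 2)).injective
    rw [h1Equiv_symplecticRep, map_add, map_smul, coe_transvection, intersectionForm_apply]
    rw [transvection_map, ← Function.comp_assoc, show ZMod.castHom h (ZMod 2) ∘ halfEmbedding L h = id
      from funext (castHom_halfEmbedding L h h4), Function.id_comp, add_mulVec, one_mulVec,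
      vecMulVec_mulVec, op_smul_eq_smul, dotProduct_comm]
  mul_elt M v := by
    rw [mul_transvection]
    congr 2
    ext i
    rw [Function.comp_apply, h1Equiv_symplecticRep]
    simp only [mulVec, dotProduct, map_sum, map_apply, halfEmbedding_castHom_mul,
      Function.comp_apply]

/-- The quadratic refinement of the intersection form vanishing on the loops. -/
noncomputable def arfForm (x : H1 g (ZMod 2)) : ZMod 2 :=
  ∑ i : Fin g, h1Equiv g (ZMod 2) x (Sum.inl i) * h1Equiv g (ZMod 2) x (Sum.inr i)

theorem arfForm_add (x y : H1 g (ZMod 2)) :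
    arfForm g (x + y) = arfForm g x + arfForm g y + intersectionForm g x y := by
  rw [intersectionForm_apply]
  simp only [arfForm, map_add, Pi.add_apply]
  simp [J, fromBlocks_mulVec, dotProduct, Fintype.sum_sum_type, neg_mulVec, CharTwo.neg_eq,
    ← Finset.sum_add_distrib]
  refine Finset.sum_congr rfl fun i _ => ?_
  ring

end Surface

theorem mainTheorem7 (g L : ℕ) (hg : 3 ≤ g) (hL : 2 ≤ L) (h2 : 2 ∣ L) (h4 : ¬ 4 ∣ L) :
    Nonempty (groupHomology (Rep.of (Surface.symplecticRep g L h2)) 1 ≃+ ZMod 2) := by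
  have : FiniteDimensional (ZMod 2) (Surface.H1 g (ZMod 2)) :=
    (Surface.symplecticBasis g (ZMod 2)).finiteDimensional_of_finite
  have hdim : Module.finrank (ZMod 2) (Surface.H1 g (ZMod 2)) = g + g := by
    rw [Module.finrank_eq_card_basis (Surface.symplecticBasis g (ZMod 2))]
    simp
  exact groupHomology.nonempty_addEquiv_zmod_two _ (Surface.transvectionFamily g L h2 h4)
    (by lia) (Surface.arfForm_add g)
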